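/- Let $n\ge 2$. A marked metric graph $A$ of rank $n$ is a finite connected graph, all of whose vertices have valence at least three, with positive edge lengths and a homotopy equivalence (marking) from the rose $R_n$ with $n$ petals, so that $F_n=\pi_1(R_n)\cong\pi_1(A)$. For $w\in F_n$ let $l_A(w)$ be the length of a shortest loop in the free homotopy class corresponding to $w$. Outer Space $CV_n$ is the set of marked metric graphs up to homotheties which commute with the markings up to free homotopy, with the topology induced by $A\mapsto[l_A]\in\mathbb R^{F_n}/\!\sim$, where $\mathbb R^{F_n}$ has the topology of pointwise convergence and $\sim$ is multiplication by positive real numbers; $\overline{CV_n}$ is its closure among the classes of non-zero functions. Put $$\Lambda_R(A,B)=\sup_{1\ne w\in F_n}\frac{l_B(w)}{l_A(w)},\qquad d_R(A,B)=\log\Lambda_R(\bar A,\bar B)\quad (A,B\in CV_n),$$ where $\bar A,\bar B$ are the representatives of volume (total edge length) one. A sequence $(A_k)$ in $CV_n$ is right-hand Cauchy if $d_R(A_k,A_{k+m})\to0$ as $k\to\infty$, uniformly in $m\ge 0$. **Theorem (Incompleteness).** The space $(CV_n,d_R)$ is not complete: not every right-hand Cauchy sequence converges in $CV_n$. Namely,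 let $A_k$ ($k\ge1$) be the rose with the standard marking which is obtained from the rose with $n$ petals of equal length by multiplying the length of one fixed petal by $1/k$ and normalising to volume one. Then $(A_k)$ is a right-hand Cauchy sequence with no accumulation point in $CV_n$; moreover, there is no $B\in CV_n$ such that $d_R(A_k,B)\to 0$ along a subsequence. Furthermore, $\Lambda_R(A,B)<\infty$ for every marked metric graph $A$ of rank $n$ and every $B\in\overline{CV_n}\setminus CV_n$ (where $l_B$ is any function in the projective class $B$). -/

import Mathlib

open Filter Topology

/-- A finite metric graph. Every geometric edge `e : E` carries a reference orientation from
`src e` to `tgt e` (used for bookkeeping only) and a positive length. Loops and multiple edges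
are allowed. -/
structure MetricGraph where
  V : Type
  E : Type
  [fintypeV : Fintype V]
  [fintypeE : Fintype E]
  src : E → V
  tgt : E → V
  length : E → ℝ
  length_pos : ∀ e, 0 < length e

attribute [instance] MetricGraph.fintypeV MetricGraph.fintypeE

namespace MetricGraph

/-- Oriented edges: `(e, true)` is `e` with its reference orientation, `(e, false)` is `e` with the
opposite one. This is the alphabet of the words that represent elements of `FreeGroup E`. -/
abbrev OEdge (G : MetricGraph) : Type := G.E × Bool

/-- The initial vertex of an oriented edge. -/
def init (G : MetricGraph) (d : G.OEdge) : G.V := if d.2 then G.src d.1 else G.tgt d.1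

/-- The terminal vertex of an oriented edge. -/
def term (G : MetricGraph) (d : G.OEdge) : G.V := if d.2 then G.tgt d.1 else G.src d.1

/-- The same edge with the opposite orientation. -/
def flip (G : MetricGraph) (d : G.OEdge) : G.OEdge := (d.1, !d.2)

/-- `G.IsWalk u v L`: the list `L` of oriented edges is an edge path from `u` to `v`. -/
def IsWalk (G : MetricGraph) : G.V → G.V → List G.OEdge → Prop
  | u, v, [] => u = v
  | u, v, d :: L => G.init d = u ∧ IsWalk G (G.term d) v L

/-- The length of an edge path. -/
def walkLength (G : MetricGraph) (L : List G.OEdge) : ℝ := (L.map fun d => G.length d.1).sum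

/-- The volume: the sum of the lengths of all edges. -/
def volume (G : MetricGraph) : ℝ := ∑ e, G.length e

/-- The number of oriented edges issuing from `v` (a loop at `v` counts twice). -/
noncomputable def valence (G : MetricGraph) (v : G.V) : ℕ := Nat.card {d : G.OEdge // G.init d = v}

theorem IsWalk.append {G : MetricGraph} {u v w : G.V} {L M : List G.OEdge}
    (h : G.IsWalk u v L) (h' : G.IsWalk v w M) : G.IsWalk u w (L ++ M) := by
  induction L generalizing u with
  | nil => cases h; exact h'
  | cons d L ih => exact ⟨h.1, ih h.2⟩

theorem IsWalk.reverse {G : MetricGraph} {u v : G.V} {L : List G.OEdge}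
    (h : G.IsWalk u v L) : G.IsWalk v u (FreeGroup.invRev L) := by
  induction L generalizing u with
  | nil => cases h; rfl
  | cons d L ih =>
    obtain ⟨h1, h2⟩ := h
    have : FreeGroup.invRev (d :: L) = FreeGroup.invRev L ++ [G.flip d] := by
      simp [FreeGroup.invRev, flip]
    rw [this]
    refine (ih h2).append ⟨?_, ?_⟩
    · rcases d with ⟨e, _ | _⟩ <;> simp [init, term, flip]
    · subst h1
      rcases d with ⟨e, _ | _⟩ <;> simp [IsWalk, init, term, flip]

/-- The fundamental group `π₁(G, v)`, realised (as in Bass-Serre theory) as the subgroup of the free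
group on the edges whose elements are the values of the closed edge paths at `v`. Two edge paths
from `u` to `v` are homotopic relative to their endpoints, i.e. differ by inserting and deleting
backtracks, if and only if they have the same value in `FreeGroup E`. -/
def fundGroup (G : MetricGraph) (v : G.V) : Subgroup (FreeGroup G.E) where
  carrier := {g | ∃ L, G.IsWalk v v L ∧ FreeGroup.mk L = g}
  mul_mem' := by
    rintro _ _ ⟨L, hL, rfl⟩ ⟨M, hM, rfl⟩
    exact ⟨L ++ M, hL.append hM, FreeGroup.mul_mk.symm⟩
  one_mem' := ⟨[], rfl, rfl⟩
  inv_mem' := by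
    rintro _ ⟨L, hL, rfl⟩
    exact ⟨_, hL.reverse, FreeGroup.inv_mk.symm⟩

/-- A homothety of ratio `ratio` between metric graphs all of whose vertices have valence at least
three: an isomorphism of graphs which multiplies all edge lengths by `ratio`. It may reverse
reference orientations. -/
structure Homothety (G H : MetricGraph) where
  onV : G.V ≃ H.V
  onE : G.OEdge ≃ H.OEdge
  ratio : ℝ
  ratio_pos : 0 < ratio
  map_flip : ∀ d, onE (G.flip d) = H.flip (onE d)
  map_init : ∀ d, H.init (onE d) = onV (G.init d)
  map_length : ∀ d, H.length (onE d).1 = ratio * G.length d.1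

namespace Homothety

variable {G H K : MetricGraph}

/-- The homomorphism induced on values of edge paths. -/
def hom (h : Homothety G H) : FreeGroup G.E →* FreeGroup H.E :=
  FreeGroup.lift fun e => FreeGroup.mk [h.onE (e, true)]

theorem hom_mk (h : Homothety G H) (L : List G.OEdge) :
    h.hom (FreeGroup.mk L) = FreeGroup.mk (L.map h.onE) := by
  induction L with
  | nil => simp [← FreeGroup.one_eq_mk]
  | cons d L ih =>
    have e1 : (FreeGroup.mk (d :: L) : FreeGroup G.E) = FreeGroup.mk [d] * FreeGroup.mk L := by
      rw [FreeGroup.mul_mk]; rfl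
    have e2 : (FreeGroup.mk ((d :: L).map h.onE) : FreeGroup H.E)
        = FreeGroup.mk [h.onE d] * FreeGroup.mk (L.map h.onE) := by
      rw [FreeGroup.mul_mk]; rfl
    rw [e1, e2, map_mul, ih]
    congr 1
    rcases d with ⟨e, _ | _⟩
    · have h1 := h.map_flip (e, true)
      simp only [flip, Bool.not_true] at h1
      rw [h1]
      simp [hom, FreeGroup.lift_mk, FreeGroup.inv_mk, FreeGroup.invRev]
    · simp [hom, FreeGroup.lift_mk]

theorem map_term (h : Homothety G H) (d : G.OEdge) : H.term (h.onE d) = h.onV (G.term d) := by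
  have h1 := h.map_init (G.flip d)
  rw [h.map_flip] at h1
  have key : ∀ (K : MetricGraph) (d : K.OEdge), K.init (K.flip d) = K.term d := by
    rintro K ⟨e, _ | _⟩ <;> simp [init, term, flip]
  rwa [key, key] at h1

theorem map_walk (h : Homothety G H) {u v : G.V} {L : List G.OEdge} (hL : G.IsWalk u v L) :
    H.IsWalk (h.onV u) (h.onV v) (L.map h.onE) := by
  induction L generalizing u with
  | nil => exact congrArg h.onV hL
  | cons d L ih =>
    refine ⟨by rw [h.map_init, hL.1], ?_⟩
    have h1 := ih hL.2
    rwa [← h.map_term] at h1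

theorem walkLength_map (h : Homothety G H) (L : List G.OEdge) :
    H.walkLength (L.map h.onE) = h.ratio * G.walkLength L := by
  induction L with
  | nil => simp [walkLength]
  | cons d L ih =>
    simp only [walkLength, List.map_cons, List.sum_cons, h.map_length] at ih ⊢
    rw [ih]; ring

theorem volume_eq (h : Homothety G H) : H.volume = h.ratio * G.volume := by
  have key : ∀ K : MetricGraph, ∑ d : K.OEdge, K.length d.1 = 2 * K.volume := by
    intro K
    rw [Fintype.sum_prod_type]
    simp [volume, Finset.mul_sum, two_mul]
  have h1 : ∑ d : H.OEdge, H.length d.1 = h.ratio * ∑ d : G.OEdge, G.length d.1 := by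
    rw [Finset.mul_sum, ← h.onE.sum_comp]
    exact Finset.sum_congr rfl fun d _ => h.map_length d
  rw [key, key] at h1
  linarith

/-- The identity. -/
def refl (G : MetricGraph) : Homothety G G where
  onV := Equiv.refl _
  onE := Equiv.refl _
  ratio := 1
  ratio_pos := one_pos
  map_flip _ := rfl
  map_init _ := rfl
  map_length _ := (one_mul _).symm

/-- The inverse homothety. -/
noncomputable def symm (h : Homothety G H) : Homothety H G where
  onV := h.onV.symm
  onE := h.onE.symm
  ratio := h.ratio⁻¹
  ratio_pos := inv_pos.2 h.ratio_pos
  map_flip d := by rw [Equiv.symm_apply_eq, h.map_flip, Equiv.apply_symm_apply]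
  map_init d := by rw [Equiv.eq_symm_apply, ← h.map_init, Equiv.apply_symm_apply]
  map_length d := by
    have h1 := h.map_length (h.onE.symm d)
    rw [Equiv.apply_symm_apply] at h1
    rw [h1, inv_mul_cancel_left₀ h.ratio_pos.ne']

/-- The composition of two homotheties. -/
noncomputable def trans (h : Homothety G H) (k : Homothety H K) : Homothety G K where
  onV := h.onV.trans k.onV
  onE := h.onE.trans k.onE
  ratio := k.ratio * h.ratio
  ratio_pos := mul_pos k.ratio_pos h.ratio_pos
  map_flip d := by simp [h.map_flip, k.map_flip]
  map_init d := by simp [h.map_init, k.map_init]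
  map_length d := by simp [h.map_length, k.map_length, mul_assoc]

theorem hom_refl (g : FreeGroup G.E) : (refl G).hom g = g := by
  obtain ⟨L, rfl⟩ := Quot.exists_rep g
  exact ((refl G).hom_mk L).trans (congrArg FreeGroup.mk (by simp [refl]))

theorem hom_symm_hom (h : Homothety G H) (g : FreeGroup G.E) : h.symm.hom (h.hom g) = g := by
  obtain ⟨L, rfl⟩ := Quot.exists_rep g
  change h.symm.hom (h.hom (FreeGroup.mk L)) = FreeGroup.mk L
  rw [hom_mk, hom_mk, List.map_map]
  exact congrArg FreeGroup.mk (by simp [symm])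

theorem hom_trans (h : Homothety G H) (k : Homothety H K) (g : FreeGroup G.E) :
    (h.trans k).hom g = k.hom (h.hom g) := by
  obtain ⟨L, rfl⟩ := Quot.exists_rep g
  change (h.trans k).hom (FreeGroup.mk L) = k.hom (h.hom (FreeGroup.mk L))
  rw [hom_mk, hom_mk, hom_mk, List.map_map]
  rfl

end Homothety

end MetricGraph

/-- A marked metric graph of rank `n`: a finite connected metric graph all of whose vertices have
valence at least three, with a marking. A homotopy equivalence from the rose with `n` petals to the
graph is given, up to homotopy, by the image `base` of the vertex of the rose together with the
isomorphism which it induces from the free group `F_n` to the fundamental group at `base`. -/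
structure MarkedGraph (n : ℕ) extends MetricGraph where
  connected : ∀ u v, ∃ L, toMetricGraph.IsWalk u v L
  three_le_valence : ∀ v, 3 ≤ toMetricGraph.valence v
  base : V
  marking : FreeGroup (Fin n) ≃* toMetricGraph.fundGroup base

namespace MarkedGraph

variable {n : ℕ}

/-- The lengths of the closed edge paths in `A` (with any initial vertex `u`) in the free homotopy
class which corresponds to the conjugacy class of `w`. A walk `γ` from the base point to `u` gives
a vertex `p` of the universal covering tree of `A`, and `L` then lifts to an edge path from `p` to
`w p`. -/
def loopLengths (A : MarkedGraph n) (w : FreeGroup (Fin n)) : Set ℝ :=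
  {r | ∃ (u : A.V) (γ L : List A.OEdge), A.IsWalk A.base u γ ∧ A.IsWalk u u L ∧
    FreeGroup.mk L = (FreeGroup.mk γ)⁻¹ * (A.marking w : FreeGroup A.E) * FreeGroup.mk γ ∧
    A.walkLength L = r}

/-- The translation length `l_A(w)`: the length of a shortest loop in the free homotopy class
of `w`. -/
noncomputable def len (A : MarkedGraph n) (w : FreeGroup (Fin n)) : ℝ := sInf (A.loopLengths w)

/-- Marked graphs are equivalent if there is a homothety `h` between them such that `h ∘ τ_A` and
`τ_B` are freely homotopic, the base point moving along the edge path `γ` during the homotopy. -/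
def Equivalent (A B : MarkedGraph n) : Prop :=
  ∃ (h : MetricGraph.Homothety A.toMetricGraph B.toMetricGraph) (γ : List B.OEdge),
    B.IsWalk (h.onV A.base) B.base γ ∧
    ∀ w, (B.marking w : FreeGroup B.E) =
      (FreeGroup.mk γ)⁻¹ * h.hom (A.marking w) * FreeGroup.mk γ

theorem Equivalent.refl (A : MarkedGraph n) : A.Equivalent A :=
  ⟨MetricGraph.Homothety.refl _, [], rfl, fun w => by
    rw [MetricGraph.Homothety.hom_refl, ← FreeGroup.one_eq_mk]; simp⟩

theorem Equivalent.symm {A B : MarkedGraph n} (hAB : A.Equivalent B) : B.Equivalent A := by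
  obtain ⟨h, γ, hγ, hw⟩ := hAB
  refine ⟨h.symm, (FreeGroup.invRev γ).map h.symm.onE, ?_, fun w => ?_⟩
  · have h1 := h.symm.map_walk hγ.reverse
    have h2 : h.symm.onV (h.onV A.base) = A.base := h.onV.symm_apply_apply _
    rwa [h2] at h1
  · rw [hw w, ← MetricGraph.Homothety.hom_mk, ← FreeGroup.inv_mk]
    simp only [map_mul, map_inv, MetricGraph.Homothety.hom_symm_hom]
    group

theorem Equivalent.trans {A B C : MarkedGraph n} (hAB : A.Equivalent B) (hBC : B.Equivalent C) :
    A.Equivalent C := by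
  obtain ⟨h, γ, hγ, hw⟩ := hAB
  obtain ⟨k, δ, hδ, hw'⟩ := hBC
  refine ⟨h.trans k, γ.map k.onE ++ δ, (k.map_walk hγ).append hδ, fun w => ?_⟩
  rw [hw' w, hw w, ← FreeGroup.mul_mk, ← MetricGraph.Homothety.hom_mk,
    MetricGraph.Homothety.hom_trans]
  simp only [map_mul, map_inv]
  group

theorem Equivalent.mul_mem {A B : MarkedGraph n}
    {h : MetricGraph.Homothety A.toMetricGraph B.toMetricGraph} {γ : List B.OEdge}
    (hγ : B.IsWalk (h.onV A.base) B.base γ)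
    (hw : ∀ w, (B.marking w : FreeGroup B.E) =
      (FreeGroup.mk γ)⁻¹ * h.hom (A.marking w) * FreeGroup.mk γ)
    {w : FreeGroup (Fin n)} {r : ℝ} (hr : r ∈ A.loopLengths w) :
    h.ratio * r ∈ B.loopLengths w := by
  obtain ⟨u, δ, L, hδ, hL, he, rfl⟩ := hr
  refine ⟨h.onV u, FreeGroup.invRev γ ++ δ.map h.onE, L.map h.onE,
    hγ.reverse.append (h.map_walk hδ), h.map_walk hL, ?_, h.walkLength_map L⟩
  rw [hw w, ← FreeGroup.mul_mk, ← FreeGroup.inv_mk, ← MetricGraph.Homothety.hom_mk,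
    ← MetricGraph.Homothety.hom_mk, he]
  simp only [map_mul, map_inv]
  group

theorem walkLength_nonneg (G : MetricGraph) (L : List G.OEdge) : 0 ≤ G.walkLength L :=
  List.sum_nonneg fun x hx => by
    obtain ⟨d, -, rfl⟩ := List.mem_map.1 hx
    exact (G.length_pos d.1).le

theorem loopLengths_nonempty (A : MarkedGraph n) (w : FreeGroup (Fin n)) :
    (A.loopLengths w).Nonempty := by
  obtain ⟨L, hL, he⟩ := (A.marking w).2
  exact ⟨_, A.base, [], L, rfl, hL, by rw [he, ← FreeGroup.one_eq_mk]; simp, rfl⟩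

theorem loopLengths_bddBelow (A : MarkedGraph n) (w : FreeGroup (Fin n)) :
    BddBelow (A.loopLengths w) :=
  ⟨0, by rintro _ ⟨_, _, L, _, _, _, rfl⟩; exact walkLength_nonneg _ L⟩

/-- Equivalent marked graphs have proportional length functions and volumes. -/
theorem Equivalent.exists_ratio {A B : MarkedGraph n} (hAB : A.Equivalent B) :
    ∃ c : ℝ, 0 < c ∧ (∀ w, B.len w = c * A.len w) ∧ B.volume = c * A.volume := by
  have half : ∀ {A B : MarkedGraph n}
      (h : MetricGraph.Homothety A.toMetricGraph B.toMetricGraph) (w : FreeGroup (Fin n)),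
      (∀ r ∈ A.loopLengths w, h.ratio * r ∈ B.loopLengths w) →
      B.len w ≤ h.ratio * A.len w := by
    intro A B h w hm
    rw [← div_le_iff₀' h.ratio_pos]
    refine le_csInf (A.loopLengths_nonempty w) fun r hr => ?_
    rw [div_le_iff₀' h.ratio_pos]
    exact csInf_le (B.loopLengths_bddBelow w) (hm r hr)
  obtain ⟨h, γ, hγ, hw⟩ := hAB
  refine ⟨h.ratio, h.ratio_pos, fun w => le_antisymm ?_ ?_, h.volume_eq⟩
  · exact half h w fun r hr => Equivalent.mul_mem hγ hw hr
  · have h1 : A.len w ≤ h.symm.ratio * B.len w := by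
      refine half h.symm w fun r hr => ?_
      refine Equivalent.mul_mem (γ := (FreeGroup.invRev γ).map h.symm.onE) ?_ (fun w => ?_) hr
      · have h1 := h.symm.map_walk hγ.reverse
        have h2 : h.symm.onV (h.onV A.base) = A.base := h.onV.symm_apply_apply _
        rwa [h2] at h1
      · rw [hw w, ← MetricGraph.Homothety.hom_mk, ← FreeGroup.inv_mk]
        simp only [map_mul, map_inv, MetricGraph.Homothety.hom_symm_hom]
        group
    exact (le_inv_mul_iff₀ h.ratio_pos).1 h1

instance setoid (n : ℕ) : Setoid (MarkedGraph n) where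
  r := Equivalent
  iseqv := ⟨Equivalent.refl, Equivalent.symm, Equivalent.trans⟩

theorem rose_isWalk (E : Type) [Fintype E] (ℓ : E → ℝ) (hℓ : ∀ e, 0 < ℓ e) (u v : Unit)
    (L : List (E × Bool)) :
    (MetricGraph.mk Unit E (fun _ => ()) (fun _ => ()) ℓ hℓ).IsWalk u v L := by
  induction L generalizing u with
  | nil => rfl
  | cons d L ih => exact ⟨rfl, ih _⟩

/-- The standard rose with petals of lengths `ℓ i`, for `i` in `Fin n`: one vertex, `n` loops, and
the marking which sends the `i`-th generator of `F_n` to the `i`-th petal. -/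
noncomputable def rose {n : ℕ} (hn : 2 ≤ n) (ℓ : Fin n → ℝ) (hℓ : ∀ i, 0 < ℓ i) :
    MarkedGraph n where
  V := Unit
  E := Fin n
  src := fun _ => ()
  tgt := fun _ => ()
  length := ℓ
  length_pos := hℓ
  connected := fun u v => ⟨[], rose_isWalk (Fin n) ℓ hℓ u v []⟩
  three_le_valence := fun v => by
    have : ∀ d : Fin n × Bool,
        (MetricGraph.mk Unit (Fin n) (fun _ => ()) (fun _ => ()) ℓ hℓ).init d = v := fun _ => rfl
    rw [MetricGraph.valence, Nat.card_congr (Equiv.subtypeUnivEquiv this)]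
    simp only [Nat.card_eq_fintype_card, Fintype.card_prod, Fintype.card_fin,
      Fintype.card_bool]
    omega
  base := ()
  marking := Subgroup.topEquiv.symm.trans (MulEquiv.subgroupCongr (by
    symm
    rw [eq_top_iff]
    intro g _
    obtain ⟨L, rfl⟩ := Quot.exists_rep g
    exact ⟨L, rose_isWalk (Fin n) ℓ hℓ _ _ L, rfl⟩))

end MarkedGraph

/-- Outer Space (Culler-Vogtmann space) of rank `n`. -/
def CV (n : ℕ) : Type 1 := Quotient (MarkedGraph.setoid n)

/-- Two real functions on `F_n` are homothetic if they differ by a positive factor. -/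
instance lengthSetoid (n : ℕ) : Setoid (FreeGroup (Fin n) → ℝ) where
  r f g := ∃ c : ℝ, 0 < c ∧ g = c • f
  iseqv :=
    { refl := fun f => ⟨1, one_pos, (one_smul ℝ f).symm⟩
      symm := by
        rintro f _ ⟨c, hc, rfl⟩
        exact ⟨c⁻¹, inv_pos.2 hc, (inv_smul_smul₀ hc.ne' f).symm⟩
      trans := by
        rintro f _ _ ⟨c, hc, rfl⟩ ⟨d, hd, rfl⟩
        exact ⟨d * c, mul_pos hd hc, (mul_smul d c f).symm⟩ }

/-- The quotient of `ℝ^{F_n}` (with the topology of pointwise convergence) by homothety, with the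
quotient topology. -/
def ProjLength (n : ℕ) : Type := Quotient (lengthSetoid n)

instance (n : ℕ) : TopologicalSpace (ProjLength n) :=
  inferInstanceAs (TopologicalSpace (Quotient (lengthSetoid n)))

/-- The class of a function up to homothety. -/
def ProjLength.mk {n : ℕ} (f : FreeGroup (Fin n) → ℝ) : ProjLength n :=
  Quotient.mk (lengthSetoid n) f

namespace CV

variable {n : ℕ}

/-- The point of Outer Space given by a marked metric graph. -/
def mk (A : MarkedGraph n) : CV n := Quotient.mk (MarkedGraph.setoid n) A

/-- The map from Outer Space to projective length functions. -/
noncomputable def proj : CV n → ProjLength n :=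
  Quotient.lift (fun A : MarkedGraph n => ProjLength.mk A.len) (by
    intro A B hAB
    obtain ⟨c, hc, h, -⟩ := MarkedGraph.Equivalent.exists_ratio hAB
    exact Quotient.sound ⟨c, hc, funext h⟩)

/-- Outer Space has the topology induced from the space of projective length functions. -/
noncomputable instance : TopologicalSpace (CV n) := TopologicalSpace.induced proj inferInstance

/-- The length function of the representative of volume one. -/
noncomputable def unitLen : CV n → FreeGroup (Fin n) → ℝ :=
  Quotient.lift (fun (A : MarkedGraph n) w => A.len w / A.volume) (by
    intro A B hAB
    obtain ⟨c, hc, h, hv⟩ := MarkedGraph.Equivalent.exists_ratio hAB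
    funext w
    simp only [h, hv, mul_div_mul_left _ _ hc.ne'])

/-- The boundary of Outer Space: the projective classes of non-zero functions in the closure of
Outer Space which are not in Outer Space itself. -/
def boundary (n : ℕ) : Set (ProjLength n) :=
  {b | b ∈ closure (Set.range (proj (n := n))) ∧ b ∉ Set.range (proj (n := n)) ∧
    b ≠ ProjLength.mk 0}

end CV

/-- The right hand factor `Λ_R = sup_{w ≠ 1} l_B(w) / l_A(w)` of two length functions, as an extended
real number. (The denominator is positive for the length function of a marked metric graph.) -/
noncomputable def lambdaR {n : ℕ} (lA lB : FreeGroup (Fin n) → ℝ) : EReal :=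
  ⨆ (w : FreeGroup (Fin n)) (_ : w ≠ 1), ((lB w / lA w : ℝ) : EReal)

namespace CV

variable {n : ℕ}

/-- The right hand non-symmetric metric `d_R(A, B) = log Λ_R(Ā, B̄)`, where `Ā` and `B̄` are the
representatives of volume one. -/
noncomputable def dR (A B : CV n) : EReal :=
  ENNReal.log (lambdaR A.unitLen B.unitLen).toENNReal

/-- Right hand Cauchy sequences: `d_R(A_k, A_{k+m}) → 0` as `k → ∞`, uniformly in `m`. -/
def RightCauchy (a : ℕ → CV n) : Prop :=
  ∀ ε : ℝ, 0 < ε → ∃ K, ∀ k, K ≤ k → ∀ m, dR (a k) (a (k + m)) < (ε : EReal)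

/-- `(CV_n, d_R)` is complete: every right hand Cauchy sequence converges in Outer Space. -/
def RightComplete (n : ℕ) : Prop :=
  ∀ a : ℕ → CV n, RightCauchy a → ∃ B, Tendsto a atTop (𝓝 B)

end CV

/-! An edge path has a value in the free group on the edges, and each edge letter is weighted by its
length. Reducing an edge path cancels backtracks and keeps it an edge path, so `l_A(w)` is the
weight of the cyclic reduction of the marked element (`len_eq_cyclicWeight`). For a rose this reads
off the lengths of the petals and compares two roses letter by letter.

Incompleteness: as one petal shrinks, every other normalised petal grows by a bounded factor tending
to one, so the sequence is right-hand Cauchy. The ratio of the short petal to another one is a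
projective invariant that tends to zero, whereas it is positive at every point of Outer Space; this
excludes accumulation points. The volume-one length of the short petal tends to zero too, so
`Λ_R(A_k, B)` is eventually large for every fixed `B`.

Finiteness at the boundary: fix `A` and label its oriented edges by elements `g i` of `F_n`, so that
a loop represents the product of its labels up to conjugacy. `exists_forall_weight_conj_le`
conjugates all labels simultaneously so that their weights in `B` are bounded by translation lengths
of the `g i` and `g i * g j`. Hence `l_B(w)` is at most `l_A(w)` times a constant depending only on
`A` times a finite sum of lengths in `B`. This inequality is closed and homogeneous, so it survives
in the closure of Outer Space. -/

namespace WeightedWord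

/-! ### Weighted words and conjugacy in free groups -/

open FreeGroup
open scoped Classical

variable {α : Type}

/-- The total weight of a word whose letters `a` and `a⁻¹` have weight `c a`. -/
def wordWeight (c : α → ℝ) (L : List (α × Bool)) : ℝ := (L.map fun d => c d.1).sum

theorem wordWeight_nil (c : α → ℝ) : wordWeight c [] = 0 := rfl

theorem wordWeight_cons (c : α → ℝ) (d : α × Bool) (L : List (α × Bool)) :
    wordWeight c (d :: L) = c d.1 + wordWeight c L := by
  simp [wordWeight]

theorem wordWeight_append (c : α → ℝ) (L M : List (α × Bool)) :
    wordWeight c (L ++ M) = wordWeight c L + wordWeight c M := by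
  simp [wordWeight]

theorem wordWeight_invRev (c : α → ℝ) (L : List (α × Bool)) :
    wordWeight c (invRev L) = wordWeight c L := by
  simp [wordWeight, invRev, List.sum_reverse, Function.comp_def]

theorem wordWeight_flatten_replicate (c : α → ℝ) (k : ℕ) (L : List (α × Bool)) :
    wordWeight c (List.replicate k L).flatten = k * wordWeight c L := by
  induction k with
  | zero => simp [wordWeight_nil]
  | succ k ih =>
    rw [List.replicate_succ, List.flatten_cons, wordWeight_append, ih]
    push_cast
    ring

theorem mk_flatten_replicate (k : ℕ) (L : List (α × Bool)) :
    (mk (List.replicate k L).flatten : FreeGroup α) = mk L ^ k := by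
  induction k with
  | zero => simp [one_eq_mk]
  | succ k ih =>
    rw [List.replicate_succ, List.flatten_cons, ← mul_mk, ih, pow_succ']

theorem wordWeight_nonneg {c : α → ℝ} (hc : ∀ a, 0 ≤ c a) (L : List (α × Bool)) :
    0 ≤ wordWeight c L :=
  List.sum_nonneg fun x hx => by
    obtain ⟨d, -, rfl⟩ := List.mem_map.1 hx
    exact hc d.1

theorem wordWeight_le_of_sublist {c : α → ℝ} (hc : ∀ a, 0 ≤ c a) {L M : List (α × Bool)}
    (h : L.Sublist M) : wordWeight c L ≤ wordWeight c M := by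
  induction h with
  | slnil => exact le_rfl
  | cons d _ ih => rw [wordWeight_cons]; linarith [hc d.1]
  | cons_cons d _ ih => rw [wordWeight_cons, wordWeight_cons]; linarith

/-- The weight of the reduced word which represents an element of a free group. -/
noncomputable def weight (c : α → ℝ) (g : FreeGroup α) : ℝ := wordWeight c g.toWord

/-- The weight of the cyclic reduction of an element of a free group. -/
noncomputable def cyclicWeight (c : α → ℝ) (g : FreeGroup α) : ℝ :=
  wordWeight c (reduceCyclically g.toWord)

theorem weight_mk_of_isReduced (c : α → ℝ) {L : List (α × Bool)} (h : IsReduced L) :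
    weight c (mk L) = wordWeight c L := by
  rw [weight, toWord_mk, h.reduce_eq]

theorem weight_inv (c : α → ℝ) (g : FreeGroup α) : weight c g⁻¹ = weight c g := by
  rw [weight, toWord_inv, wordWeight_invRev, weight]

theorem weight_one (c : α → ℝ) : weight c 1 = 0 := by
  rw [weight, toWord_one, wordWeight_nil]

theorem weight_nonneg {c : α → ℝ} (hc : ∀ a, 0 ≤ c a) (g : FreeGroup α) : 0 ≤ weight c g :=
  wordWeight_nonneg hc _

theorem cyclicWeight_nonneg {c : α → ℝ} (hc : ∀ a, 0 ≤ c a) (g : FreeGroup α) :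
    0 ≤ cyclicWeight c g :=
  wordWeight_nonneg hc _

theorem cyclicWeight_of (c : α → ℝ) (a : α) : cyclicWeight c (of a) = c a := by
  rw [cyclicWeight, toWord_of, reduceCyclically.singleton, wordWeight_cons, wordWeight_nil,
    add_zero]

theorem weight_mk_le {c : α → ℝ} (hc : ∀ a, 0 ≤ c a) (L : List (α × Bool)) :
    weight c (mk L) ≤ wordWeight c L := by
  rw [weight, toWord_mk]
  exact wordWeight_le_of_sublist hc reduce.red.sublist

theorem weight_mul_le {c : α → ℝ} (hc : ∀ a, 0 ≤ c a) (g h : FreeGroup α) :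
    weight c (g * h) ≤ weight c g + weight c h := by
  rw [weight, weight, weight, ← wordWeight_append]
  exact wordWeight_le_of_sublist hc (toWord_mul_sublist g h)

theorem weight_conj_list_prod_le {c : α → ℝ} (hc : ∀ a, 0 ≤ c a) (γ : FreeGroup α) {D : ℝ}
    (l : List (FreeGroup α)) (h : ∀ g ∈ l, weight c (γ⁻¹ * g * γ) ≤ D) :
    weight c (γ⁻¹ * l.prod * γ) ≤ l.length * D := by
  induction l with
  | nil => simp [weight_one]
  | cons g l ih =>
    have h1 := h g (by simp)
    have h2 := ih fun g' hg' => h g' (by simp [hg'])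
    have e : γ⁻¹ * (g :: l).prod * γ = (γ⁻¹ * g * γ) * (γ⁻¹ * l.prod * γ) := by
      rw [List.prod_cons]; group
    rw [e]
    refine (weight_mul_le hc _ _).trans ?_
    rw [List.length_cons]
    push_cast
    linarith

/-- No cancellation occurs between consecutive copies of a cyclically reduced word, so the weight of
its powers grows exactly linearly. -/
theorem weight_pow_of_isCyclicallyReduced (c : α → ℝ) {L : List (α × Bool)}
    (h : IsCyclicallyReduced L) (k : ℕ) : weight c (mk L ^ k) = k * wordWeight c L := by
  rw [← mk_flatten_replicate, weight_mk_of_isReduced c (h.flatten_replicate k).isReduced,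
    wordWeight_flatten_replicate]

theorem weight_pow_le {c : α → ℝ} (hc : ∀ a, 0 ≤ c a) (g : FreeGroup α) (k : ℕ) :
    weight c (g ^ k) ≤ k * weight c g := by
  induction k with
  | zero => simp [weight_one]
  | succ k ih =>
    rw [pow_succ]
    refine (weight_mul_le hc _ _).trans ?_
    push_cast
    linarith

/-- A cyclically reduced word has minimal weight in its conjugacy class. -/
theorem wordWeight_le_weight_conj {c : α → ℝ} (hc : ∀ a, 0 ≤ c a) {L : List (α × Bool)}
    (h : IsCyclicallyReduced L) (γ : FreeGroup α) :
    wordWeight c L ≤ weight c (γ⁻¹ * mk L * γ) := by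
  -- Compare `k`-th powers: the two conjugating factors cost at most `2 * weight c γ`, whatever `k`
  -- is, so a positive difference of growth rates is impossible.
  have key : ∀ k : ℕ, k * (wordWeight c L - weight c (γ⁻¹ * mk L * γ)) ≤ 2 * weight c γ := by
    intro k
    have e : mk L ^ k = γ * (γ⁻¹ * mk L * γ) ^ k * γ⁻¹ := by
      have := conj_pow (i := k) (a := γ⁻¹) (b := mk L)
      rw [inv_inv] at this
      rw [this]; group
    have h1 := weight_pow_of_isCyclicallyReduced c h k
    have h2 := weight_mul_le hc (γ * (γ⁻¹ * mk L * γ) ^ k) γ⁻¹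
    have h3 := weight_mul_le hc γ ((γ⁻¹ * mk L * γ) ^ k)
    have h4 := weight_pow_le hc (γ⁻¹ * mk L * γ) k
    rw [← e, weight_inv] at h2
    linarith
  by_contra! hlt
  obtain ⟨k, hk⟩ := Archimedean.arch (2 * weight c γ + 1) (sub_pos.2 hlt)
  have := key k
  rw [nsmul_eq_mul] at hk
  linarith

theorem exists_conj_eq_mk_reduceCyclically (g : FreeGroup α) :
    ∃ γ : FreeGroup α, γ⁻¹ * g * γ = mk (reduceCyclically g.toWord) := by
  refine ⟨mk (reduceCyclically.conjugator g.toWord), ?_⟩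
  have h := congrArg (mk (α := α)) (reduceCyclically.conj_conjugator_reduceCyclically g.toWord)
  rw [← mul_mk, ← mul_mk, ← inv_mk, mk_toWord] at h
  nth_rewrite 2 [← h]
  group

theorem isCyclicallyReduced_reduceCyclically_toWord (g : FreeGroup α) :
    IsCyclicallyReduced (reduceCyclically g.toWord) :=
  reduceCyclically.isCyclicallyReduced isReduced_toWord

/-- Pass to the cyclic reduction and absorb its conjugator into `γ`. Together with the next lemma,
this makes the cyclic weight the minimum of the weight over a conjugacy class. -/
theorem cyclicWeight_le_weight_conj {c : α → ℝ} (hc : ∀ a, 0 ≤ c a) (g γ : FreeGroup α) :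
    cyclicWeight c g ≤ weight c (γ⁻¹ * g * γ) := by
  obtain ⟨δ, hδ⟩ := exists_conj_eq_mk_reduceCyclically g
  have h := wordWeight_le_weight_conj hc (isCyclicallyReduced_reduceCyclically_toWord g) (δ⁻¹ * γ)
  rw [← hδ] at h
  refine h.trans_eq ?_
  congr 1
  group

theorem exists_weight_conj_eq_cyclicWeight (c : α → ℝ) (g : FreeGroup α) :
    ∃ γ : FreeGroup α, weight c (γ⁻¹ * g * γ) = cyclicWeight c g := by
  obtain ⟨δ, hδ⟩ := exists_conj_eq_mk_reduceCyclically g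
  refine ⟨δ, ?_⟩
  rw [hδ, weight_mk_of_isReduced c (isCyclicallyReduced_reduceCyclically_toWord g).isReduced,
    cyclicWeight]

theorem cyclicWeight_conj_le {c : α → ℝ} (hc : ∀ a, 0 ≤ c a) (g γ : FreeGroup α) :
    cyclicWeight c (γ⁻¹ * g * γ) ≤ cyclicWeight c g := by
  obtain ⟨δ, hδ⟩ := exists_weight_conj_eq_cyclicWeight c g
  have h := cyclicWeight_le_weight_conj hc (γ⁻¹ * g * γ) (γ⁻¹ * δ)
  rw [← hδ]
  convert h using 2
  group

theorem weight_le_cyclicWeight {c : α → ℝ} (hc : ∀ a, 0 ≤ c a) {g : FreeGroup α}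
    (h : IsCyclicallyReduced g.toWord) : weight c g ≤ cyclicWeight c g := by
  obtain ⟨γ, hγ⟩ := exists_weight_conj_eq_cyclicWeight c g
  have := wordWeight_le_weight_conj hc h γ
  rwa [mk_toWord, hγ] at this

/-- A reduced word is cyclically reduced unless its last letter is inverse to the first one. -/
theorem isCyclicallyReduced_or_exists_cons_append (g : FreeGroup α) :
    IsCyclicallyReduced g.toWord ∨
      ∃ (d : α × Bool) (M : List (α × Bool)), g.toWord = d :: (M ++ [(d.1, !d.2)]) := by
  have hr : IsReduced g.toWord := isReduced_toWord
  generalize g.toWord = L at hr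
  induction L using List.bidirectionalRec with
  | nil => simp
  | singleton d => simp
  | cons_append a M b _ =>
    by_cases hab : b.1 = a.1 → b.2 = a.2
    · left
      rw [← List.cons_append] at hr ⊢
      exact isCyclicallyReduced_cons_append_iff.2 ⟨hr, hab⟩
    · right
      push Not at hab
      refine ⟨a, M, ?_⟩
      obtain ⟨a1, a2⟩ := a
      obtain ⟨b1, b2⟩ := b
      obtain ⟨h1, h2⟩ := hab
      cases a2 <;> cases b2 <;> simp_all

/-- Conjugation by the first letter strips both outer letters, each of weight `c d.1`. -/
theorem weight_conj_letter_le {c : α → ℝ} (hc : ∀ a, 0 ≤ c a) {g : FreeGroup α} {d : α × Bool}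
    {M : List (α × Bool)} (h : g.toWord = d :: (M ++ [(d.1, !d.2)])) :
    weight c ((mk [d])⁻¹ * g * mk [d]) + 2 * c d.1 ≤ weight c g := by
  have e : (mk [d])⁻¹ * g * mk [d] = mk M := by
    have h1 : g = mk [d] * mk M * (mk [d])⁻¹ := by
      rw [← mk_toWord (x := g), h, inv_mk, mul_mk, mul_mk]
      simp [invRev]
    rw [h1]; group
  rw [e]
  have h1 := weight_mk_le hc M
  have h2 : weight c g = c d.1 + (wordWeight c M + c d.1) := by
    rw [weight, h, wordWeight_cons, wordWeight_append, wordWeight_cons, wordWeight_nil, add_zero]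
  linarith

/-- If `g'` began with `d` or ended with `d⁻¹`, conjugation by `d` would merely move that letter to
the other end and could not raise the weight. Since `g` begins with `d` and ends with `d⁻¹`, nothing
then cancels at either of the two cyclic junctions of `g` and `g'`. -/
theorem isCyclicallyReduced_append_of_weight_lt {c : α → ℝ} (hc : ∀ a, 0 ≤ c a)
    {g g' : FreeGroup α} {d : α × Bool} {M : List (α × Bool)}
    (h : g.toWord = d :: (M ++ [(d.1, !d.2)]))
    (hlt : weight c g' < weight c ((mk [d])⁻¹ * g' * mk [d])) :
    IsCyclicallyReduced (g.toWord ++ g'.toWord) := by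
  have hne : g'.toWord ≠ [] := by
    intro h0
    rw [toWord_eq_nil_iff.1 h0] at hlt
    simp only [mul_one, inv_mul_cancel, lt_irrefl] at hlt
  have hhead : ∀ b ∈ g'.toWord.head?, b ≠ d := by
    rintro b hb rfl
    obtain ⟨K, hK⟩ : ∃ K, g'.toWord = b :: K := by
      rcases hw : g'.toWord with _ | ⟨x, K⟩
      · exact absurd hw hne
      · rw [hw] at hb
        simp only [List.head?_cons, Option.mem_def, Option.some.injEq] at hb
        exact ⟨K, by rw [hb]⟩
    have e : (mk [b])⁻¹ * g' * mk [b] = mk (K ++ [b]) := by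
      have h1 : g' = mk [b] * mk K := by
        rw [← mk_toWord (x := g'), hK, mul_mk]; rfl
      rw [h1, ← mul_mk]; group
    rw [e] at hlt
    have h1 := weight_mk_le hc (K ++ [b])
    have h2 : weight c g' = c b.1 + wordWeight c K := by rw [weight, hK, wordWeight_cons]
    rw [wordWeight_append, wordWeight_cons, wordWeight_nil] at h1
    linarith
  have hlast : ∀ b ∈ g'.toWord.getLast?, b ≠ (d.1, !d.2) := by
    rintro b hb rfl
    obtain ⟨K, hK⟩ : ∃ K, g'.toWord = K ++ [(d.1, !d.2)] := by
      refine ⟨g'.toWord.dropLast, ?_⟩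
      exact (List.dropLast_append_getLast? _ hb).symm
    have hd : mk [(d.1, !d.2)] = (mk [d] : FreeGroup α)⁻¹ := by simp [inv_mk, invRev]
    have e : (mk [d])⁻¹ * g' * mk [d] = mk ((d.1, !d.2) :: K) := by
      have h1 : g' = mk K * (mk [d])⁻¹ := by
        rw [← mk_toWord (x := g'), hK, ← hd, mul_mk]
      have h2 : (mk ((d.1, !d.2) :: K) : FreeGroup α) = (mk [d])⁻¹ * mk K := by
        rw [← hd, mul_mk]; rfl
      rw [h1, h2]; group
    rw [e] at hlt
    have h1 := weight_mk_le hc ((d.1, !d.2) :: K)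
    have h2 : weight c g' = wordWeight c K + c d.1 := by
      rw [weight, hK, wordWeight_append, wordWeight_cons, wordWeight_nil, add_zero]
    rw [wordWeight_cons] at h1
    linarith
  have hred : IsReduced g.toWord := isReduced_toWord
  have hred' : IsReduced g'.toWord := isReduced_toWord
  refine ⟨?_, ?_⟩
  · refine List.isChain_append.2 ⟨hred, hred', ?_⟩
    intro x hx y hy hxy
    have h1 := hhead y hy
    rw [h, ← List.cons_append, List.getLast?_concat] at hx
    simp only [Option.mem_def, Option.some.injEq] at hx
    obtain ⟨d1, d2⟩ := d
    obtain ⟨y1, y2⟩ := y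
    subst hx
    cases d2 <;> cases y2 <;> simp_all
  · intro x hx y hy hxy
    rw [List.getLast?_append_of_ne_nil _ hne] at hx
    have h1 := hlast x hx
    rw [h, List.cons_append, List.head?_cons] at hy
    simp only [Option.mem_def, Option.some.injEq] at hy
    obtain ⟨d1, d2⟩ := d
    obtain ⟨x1, x2⟩ := x
    subst hy
    cases d2 <;> cases x2 <;> simp_all

/-- A finite family of elements of a weighted free group has a common conjugate in which all
weights are bounded by cyclic weights of the elements and of their pairwise products. -/
theorem exists_forall_weight_conj_le [Finite α] {ι : Type} [Fintype ι] {c : α → ℝ}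
    (hc : ∀ a, 0 < c a) (h : ι → FreeGroup α) :
    ∃ γ : FreeGroup α, ∀ i, weight c (γ⁻¹ * h i * γ) ≤
      ∑ j, cyclicWeight c (h j) + ∑ j, ∑ k, cyclicWeight c (h j * h k) := by
  have hc0 : ∀ a, 0 ≤ c a := fun a => (hc a).le
  obtain ⟨ε, hε, hεc⟩ : ∃ ε : ℝ, 0 < ε ∧ ∀ a, ε ≤ c a := by
    obtain hα | hα := isEmpty_or_nonempty α
    · exact ⟨1, one_pos, fun a => hα.elim a⟩
    · obtain ⟨a, ha⟩ := Finite.exists_min c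
      exact ⟨c a, hc a, ha⟩
  set F : FreeGroup α → ℝ := fun γ => ∑ i, weight c (γ⁻¹ * h i * γ) with hF
  have hF0 : ∀ γ, 0 ≤ F γ := fun γ => Finset.sum_nonneg fun i _ => weight_nonneg hc0 _
  have hbdd : BddBelow (Set.range F) := ⟨0, by rintro _ ⟨γ, rfl⟩; exact hF0 γ⟩
  -- `F` is the total displacement. A conjugator within `2 * ε` of the infimum suffices, because a
  -- single letter weighs at least `ε`.
  obtain ⟨γ, hγ⟩ := exists_lt_of_ciInf_lt (show ⨅ γ, F γ < (⨅ γ, F γ) + 2 * ε by linarith)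
  have hmin : ∀ δ, F γ < F δ + 2 * ε := fun δ => hγ.trans_le (by linarith [ciInf_le hbdd δ])
  have hsingle : ∀ j, cyclicWeight c (h j) ≤ ∑ j, cyclicWeight c (h j) := fun j =>
    Finset.single_le_sum (f := fun j => cyclicWeight c (h j))
      (fun i _ => cyclicWeight_nonneg hc0 _) (Finset.mem_univ j)
  have hdouble0 : ∀ j, 0 ≤ ∑ k, cyclicWeight c (h j * h k) := fun j =>
    Finset.sum_nonneg fun i _ => cyclicWeight_nonneg hc0 _
  have hdouble : ∀ j k, cyclicWeight c (h j * h k) ≤ ∑ j, ∑ k, cyclicWeight c (h j * h k) := by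
    intro j k
    refine (Finset.single_le_sum (f := fun k => cyclicWeight c (h j * h k))
      (fun i _ => cyclicWeight_nonneg hc0 _) (Finset.mem_univ k)).trans ?_
    exact Finset.single_le_sum (f := fun j => ∑ k, cyclicWeight c (h j * h k))
      (fun i _ => hdouble0 i) (Finset.mem_univ j)
  refine ⟨γ, fun i => ?_⟩
  obtain hcyc | ⟨d, M, hd⟩ := isCyclicallyReduced_or_exists_cons_append (γ⁻¹ * h i * γ)
  · have h1 := weight_le_cyclicWeight hc0 hcyc
    have h2 := cyclicWeight_conj_le hc0 (h i) γ
    have h3 : 0 ≤ ∑ j, ∑ k, cyclicWeight c (h j * h k) := Finset.sum_nonneg fun j _ => hdouble0 j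
    linarith [hsingle i]
  -- Moving from `γ` to `γ * mk [d]` saves `2 * c d.1` on the `i`-th element. Near-minimality forces
  -- the weight of some other element to grow.
  · obtain ⟨k, hk⟩ : ∃ k, weight c (γ⁻¹ * h k * γ) <
        weight c ((mk [d])⁻¹ * (γ⁻¹ * h k * γ) * mk [d]) := by
      by_contra! hle
      have h1 := weight_conj_letter_le hc0 hd
      have h2 : F (γ * mk [d]) + 2 * c d.1 ≤ F γ := by
        have e : ∀ j, (γ * mk [d])⁻¹ * h j * (γ * mk [d]) =
            (mk [d])⁻¹ * (γ⁻¹ * h j * γ) * mk [d] := fun j => by group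
        simp only [hF, e]
        rw [← Finset.add_sum_erase _ _ (Finset.mem_univ i),
          ← Finset.add_sum_erase _ _ (Finset.mem_univ i)]
        have h3 := Finset.sum_le_sum fun j (_ : j ∈ Finset.univ.erase i) => hle j
        linarith
      linarith [hmin (γ * mk [d]), hεc d.1]
    -- The words of the conjugated `h i` and `h k` now concatenate to a cyclically reduced word, so
    -- their weights add up to at most the cyclic weight of `h i * h k`.
    have hcyc := isCyclicallyReduced_append_of_weight_lt hc0 hd hk
    have e : mk ((γ⁻¹ * h i * γ).toWord ++ (γ⁻¹ * h k * γ).toWord) = γ⁻¹ * (h i * h k) * γ := by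
      rw [← mul_mk, mk_toWord, mk_toWord]; group
    have h1 := wordWeight_le_weight_conj hc0 hcyc
    obtain ⟨δ, hδ⟩ := exists_weight_conj_eq_cyclicWeight c (γ⁻¹ * (h i * h k) * γ)
    have h2 := h1 δ
    rw [e, hδ, wordWeight_append] at h2
    have h3 := cyclicWeight_conj_le hc0 (h i * h k) γ
    have h4 := wordWeight_nonneg hc0 (γ⁻¹ * h k * γ).toWord
    have h5 : 0 ≤ ∑ j, cyclicWeight c (h j) :=
      Finset.sum_nonneg fun j _ => cyclicWeight_nonneg hc0 _
    have h6 := hdouble i k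
    rw [weight]
    linarith

end WeightedWord

/-! ### Reduction of edge paths -/

namespace MetricGraph

variable {G : MetricGraph}

theorem isWalk_append_iff {u w : G.V} {L M : List G.OEdge} :
    G.IsWalk u w (L ++ M) ↔ ∃ v, G.IsWalk u v L ∧ G.IsWalk v w M := by
  refine ⟨fun h => ?_, fun ⟨v, h, h'⟩ => h.append h'⟩
  induction L generalizing u with
  | nil => exact ⟨u, rfl, h⟩
  | cons d L ih =>
    obtain ⟨v, h1, h2⟩ := ih h.2
    exact ⟨v, ⟨h.1, h1⟩, h2⟩

theorem IsWalk.eq_of_eq {u v v' : G.V} {L : List G.OEdge} (h : G.IsWalk u v L)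
    (h' : G.IsWalk u v' L) : v = v' := by
  induction L generalizing u with
  | nil => exact h.symm.trans h'
  | cons d L ih => exact ih h.2 h'.2

theorem term_flip (d : G.OEdge) : G.term (G.flip d) = G.init d := by
  obtain ⟨e, _ | _⟩ := d <;> simp [init, term, flip]

/-- A cancelled pair crosses an edge and returns at once, so deleting it leaves the path connected.
-/
theorem IsWalk.of_red {u v : G.V} {L M : List G.OEdge} (hr : FreeGroup.Red L M)
    (h : G.IsWalk u v L) : G.IsWalk u v M := by
  induction hr with
  | refl => exact h
  | tail _ hs ih =>
    cases hs with
    | @not L₁ L₂ x b =>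
      obtain ⟨w, h1, h2, h3, h4⟩ := isWalk_append_iff.1 ih
      have h5 : G.term (G.flip (x, b)) = w := by rw [term_flip, h2]
      exact h1.append (h5 ▸ h4)

end MetricGraph

/-! ### Translation lengths and their comparison -/

namespace MarkedGraph

open WeightedWord

variable {n : ℕ}

theorem cyclicWeight_le_of_mem_loopLengths (A : MarkedGraph n) {w : FreeGroup (Fin n)} {r : ℝ}
    (hr : r ∈ A.loopLengths w) : cyclicWeight A.length (A.marking w : FreeGroup A.E) ≤ r := by
  obtain ⟨u, γ, L, -, -, he, rfl⟩ := hr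
  have h := cyclicWeight_le_weight_conj (fun e => (A.length_pos e).le)
    (A.marking w : FreeGroup A.E) (FreeGroup.mk γ)
  rw [← he] at h
  exact h.trans (weight_mk_le (fun e => (A.length_pos e).le) L)

-- The reduced word of the marked element is a closed path at the base point. It splits as a
-- conjugator, a core and the reversed conjugator; the core is the required loop, based where the
-- conjugator ends.
open scoped Classical in
theorem cyclicWeight_mem_loopLengths (A : MarkedGraph n) (w : FreeGroup (Fin n)) :
    cyclicWeight A.length (A.marking w : FreeGroup A.E) ∈ A.loopLengths w := by
  obtain ⟨L, hL, he⟩ := (A.marking w).2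
  set g : FreeGroup A.E := (A.marking w : FreeGroup A.E) with hg
  have hwalk : A.IsWalk A.base A.base g.toWord := by
    rw [← he, FreeGroup.toWord_mk]
    exact hL.of_red FreeGroup.reduce.red
  have hconj := FreeGroup.reduceCyclically.conj_conjugator_reduceCyclically g.toWord
  rw [← hconj] at hwalk
  obtain ⟨u', h1, h2⟩ := MetricGraph.isWalk_append_iff.1 hwalk
  obtain ⟨u, h3, h4⟩ := MetricGraph.isWalk_append_iff.1 h1
  -- The reversed last piece is the conjugator again, starting from the base point. A path is
  -- determined by its start and its edges, so both ends of the core agree.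
  have h5 := h2.reverse
  rw [FreeGroup.invRev_invRev] at h5
  obtain rfl := h3.eq_of_eq h5
  refine ⟨u, _, _, h3, h4, ?_, rfl⟩
  have h6 := congrArg (FreeGroup.mk (α := A.E)) hconj
  rw [← FreeGroup.mul_mk, ← FreeGroup.mul_mk, ← FreeGroup.inv_mk, FreeGroup.mk_toWord] at h6
  rw [← hg, mul_assoc]
  exact eq_inv_mul_iff_mul_eq.2 (mul_inv_eq_iff_eq_mul.1 h6)

/-- The translation length is the weight of the cyclic reduction in the free group on the edges. -/
theorem len_eq_cyclicWeight (A : MarkedGraph n) (w : FreeGroup (Fin n)) :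
    A.len w = cyclicWeight A.length (A.marking w : FreeGroup A.E) :=
  le_antisymm (csInf_le (A.loopLengths_bddBelow w) (A.cyclicWeight_mem_loopLengths w))
    (le_csInf (A.loopLengths_nonempty w) fun _ hr => A.cyclicWeight_le_of_mem_loopLengths hr)

theorem len_mem_loopLengths (A : MarkedGraph n) (w : FreeGroup (Fin n)) :
    A.len w ∈ A.loopLengths w := by
  rw [len_eq_cyclicWeight]
  exact A.cyclicWeight_mem_loopLengths w

theorem len_nonneg (A : MarkedGraph n) (w : FreeGroup (Fin n)) : 0 ≤ A.len w := by
  rw [len_eq_cyclicWeight]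
  exact cyclicWeight_nonneg (fun e => (A.length_pos e).le) _

theorem exists_pos_mul_le_walkLength (G : MetricGraph) :
    ∃ ε : ℝ, 0 < ε ∧ ∀ L : List G.OEdge, L.length * ε ≤ G.walkLength L := by
  obtain ⟨ε, hε, h⟩ : ∃ ε : ℝ, 0 < ε ∧ ∀ e, ε ≤ G.length e := by
    obtain hE | hE := isEmpty_or_nonempty G.E
    · exact ⟨1, one_pos, fun e => hE.elim e⟩
    · obtain ⟨e, he⟩ := Finite.exists_min G.length
      exact ⟨_, G.length_pos e, he⟩
  refine ⟨ε, hε, fun L => ?_⟩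
  induction L with
  | nil => simp [MetricGraph.walkLength]
  | cons d L ih =>
    simp only [MetricGraph.walkLength, List.length_cons, List.map_cons, List.sum_cons] at ih ⊢
    push_cast
    linarith [h d.1]

/-- The infimum is attained by an edge path. That path is non-empty because the marking is
injective, and edge lengths are bounded below. -/
theorem len_pos (A : MarkedGraph n) {w : FreeGroup (Fin n)} (hw : w ≠ 1) : 0 < A.len w := by
  obtain ⟨u, γ, L, -, -, he, hr⟩ := A.len_mem_loopLengths w
  obtain ⟨ε, hε, h⟩ := exists_pos_mul_le_walkLength A.toMetricGraph
  have hL : L ≠ [] := by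
    rintro rfl
    apply hw
    rw [← FreeGroup.one_eq_mk] at he
    have h1 : (A.marking w : FreeGroup A.E) = 1 := by
      calc (A.marking w : FreeGroup A.E) = FreeGroup.mk γ *
            ((FreeGroup.mk γ)⁻¹ * (A.marking w : FreeGroup A.E) * FreeGroup.mk γ) *
            (FreeGroup.mk γ)⁻¹ := by group
        _ = 1 := by rw [← he]; group
    exact A.marking.map_eq_one_iff.1 (Subtype.ext h1)
  have h1 : (1 : ℝ) ≤ L.length := by exact_mod_cast List.length_pos_iff.2 hL
  rw [← hr]
  nlinarith [h L]

/-- Oriented edges of `A` can be labelled by elements of `F_n` so that every loop represents, up to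
conjugation, the product of the labels of its edges. -/
theorem exists_edge_label (A : MarkedGraph n) : ∃ g : A.OEdge → FreeGroup (Fin n),
    ∀ w, ∀ r ∈ A.loopLengths w, ∃ (L : List A.OEdge) (x : FreeGroup (Fin n)),
      w = x * (L.map g).prod * x⁻¹ ∧ A.walkLength L = r := by
  -- Chosen paths `p v` from the base point close up every edge `d` to the loop `p (init d) · d · p
  -- (term d)⁻¹`. Its class is the label of `d`, and labels telescope along a path.
  choose p hp using A.connected A.base
  have hlift : ∀ L, A.IsWalk A.base A.base L →
      ∃ x, (A.marking x : FreeGroup A.E) = FreeGroup.mk L := fun L hL =>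
    ⟨A.marking.symm ⟨FreeGroup.mk L, L, hL, rfl⟩, by rw [MulEquiv.apply_symm_apply]⟩
  have hedge : ∀ d, ∃ x, (A.marking x : FreeGroup A.E) =
      FreeGroup.mk (p (A.init d)) * FreeGroup.mk [d] * (FreeGroup.mk (p (A.term d)))⁻¹ := by
    intro d
    obtain ⟨x, hx⟩ := hlift (p (A.init d) ++ [d] ++ FreeGroup.invRev (p (A.term d)))
      (((hp _).append (show A.IsWalk (A.init d) (A.term d) [d] from ⟨rfl, rfl⟩)).append
        (hp _).reverse)
    exact ⟨x, by rw [hx, ← FreeGroup.mul_mk, ← FreeGroup.mul_mk, FreeGroup.inv_mk]⟩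
  choose g hg using hedge
  have hprod : ∀ (L : List A.OEdge) (u v : A.V), A.IsWalk u v L →
      (A.marking (L.map g).prod : FreeGroup A.E) =
        FreeGroup.mk (p u) * FreeGroup.mk L * (FreeGroup.mk (p v))⁻¹ := by
    intro L
    induction L with
    | nil =>
      rintro u _ rfl
      simp only [List.map_nil, List.prod_nil, map_one, Subgroup.coe_one, ← FreeGroup.one_eq_mk,
        mul_one, mul_inv_cancel]
    | cons d L ih =>
      rintro u v ⟨rfl, h2⟩
      have e : (FreeGroup.mk (d :: L) : FreeGroup A.E) = FreeGroup.mk [d] * FreeGroup.mk L := by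
        rw [FreeGroup.mul_mk]; rfl
      rw [List.map_cons, List.prod_cons, map_mul, Subgroup.coe_mul, hg, ih _ _ h2, e]
      group
  refine ⟨g, ?_⟩
  rintro w r ⟨u, γ, L, hγ, hL, he, hr⟩
  obtain ⟨x, hx⟩ := hlift (γ ++ FreeGroup.invRev (p u)) (hγ.append (hp u).reverse)
  rw [← FreeGroup.mul_mk, ← FreeGroup.inv_mk] at hx
  refine ⟨L, x, A.marking.injective (Subtype.ext ?_), hr⟩
  simp only [map_mul, map_inv, Subgroup.coe_mul, Subgroup.coe_inv]
  rw [hprod L u u hL, hx, he]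
  group

/-- The length function of any marked metric graph is bounded by that of a fixed one, with a factor
which depends on finitely many lengths only. -/
theorem exists_len_le (A : MarkedGraph n) : ∃ (C : ℝ) (g : A.OEdge → FreeGroup (Fin n)),
    ∀ (B : MarkedGraph n) (w : FreeGroup (Fin n)),
      B.len w ≤ C * A.len w * (∑ i, B.len (g i) + ∑ i, ∑ j, B.len (g i * g j)) := by
  obtain ⟨g, hg⟩ := A.exists_edge_label
  obtain ⟨ε, hε, hL⟩ := exists_pos_mul_le_walkLength A.toMetricGraph
  refine ⟨ε⁻¹, g, fun B w => ?_⟩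
  have hc0 : ∀ e, 0 ≤ B.length e := fun e => (B.length_pos e).le
  obtain ⟨L, x, hx, hr⟩ := hg w _ (A.len_mem_loopLengths w)
  -- One conjugator controls all labels at once. The weight of a product of labels is then at most
  -- the number of factors times `D`.
  obtain ⟨γ, hγ⟩ := exists_forall_weight_conj_le B.length_pos
    fun i => (B.marking (g i) : FreeGroup B.E)
  set D := ∑ i, B.len (g i) + ∑ i, ∑ j, B.len (g i * g j) with hD
  have hD0 : 0 ≤ D := add_nonneg (Finset.sum_nonneg fun i _ => B.len_nonneg _)
    (Finset.sum_nonneg fun i _ => Finset.sum_nonneg fun j _ => B.len_nonneg _)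
  have hγ' : ∀ i, weight B.length (γ⁻¹ * (B.marking (g i) : FreeGroup B.E) * γ) ≤ D := by
    intro i
    refine (hγ i).trans_eq ?_
    simp only [hD, len_eq_cyclicWeight, map_mul, Subgroup.coe_mul]
  have h1 : weight B.length (γ⁻¹ * (B.marking (L.map g).prod : FreeGroup B.E) * γ) ≤
      L.length * D := by
    have e : (B.marking (L.map g).prod : FreeGroup B.E) =
        (L.map fun i => (B.marking (g i) : FreeGroup B.E)).prod := by
      have := map_list_prod ((B.toMetricGraph.fundGroup B.base).subtype.comp
        B.marking.toMonoidHom) (L.map g)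
      rw [List.map_map] at this
      exact this
    have h2 := weight_conj_list_prod_le hc0 γ (D := D)
      (L.map fun i => (B.marking (g i) : FreeGroup B.E)) (by
        intro y hy
        obtain ⟨i, -, rfl⟩ := List.mem_map.1 hy
        exact hγ' i)
    rwa [List.length_map, ← e] at h2
  have h2 : B.len w ≤ L.length * D := by
    rw [len_eq_cyclicWeight]
    refine (cyclicWeight_le_weight_conj hc0 _ ((B.marking x : FreeGroup B.E) * γ)).trans ?_
    refine le_of_eq_of_le ?_ h1
    rw [hx]
    simp only [map_mul, map_inv, Subgroup.coe_mul, Subgroup.coe_inv]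
    congr 1
    group
  -- The number of edges of a shortest loop is at most its length divided by the lower bound `ε` for
  -- edge lengths in `A`.
  have h3 : (L.length : ℝ) ≤ ε⁻¹ * A.len w := by
    rw [le_inv_mul_iff₀ hε, ← hr, mul_comm]
    exact hL L
  exact h2.trans (mul_le_mul_of_nonneg_right h3 hD0)

end MarkedGraph

/-! ### Projective length functions and the closure of Outer Space -/

namespace ProjLength

variable {n : ℕ}

theorem mk_eq_mk_iff {f g : FreeGroup (Fin n) → ℝ} :
    mk f = mk g ↔ ∃ c : ℝ, 0 < c ∧ g = c • f :=
  Quotient.eq (r := lengthSetoid n)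

/-- Scale invariance makes `s` saturated for the quotient map. -/
theorem isOpen_image_mk {s : Set (FreeGroup (Fin n) → ℝ)} (hs : IsOpen s)
    (h : ∀ f ∈ s, ∀ c : ℝ, 0 < c → c • f ∈ s) : IsOpen (mk '' s) := by
  have e : mk ⁻¹' (mk '' s) = s := by
    ext f
    refine ⟨?_, fun hf => ⟨f, hf, rfl⟩⟩
    rintro ⟨g, hg, hgf⟩
    obtain ⟨c, hc, rfl⟩ := mk_eq_mk_iff.1 hgf
    exact h g hg c hc
  have hq : IsQuotientMap (mk (n := n)) := isQuotientMap_quotient_mk'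
  rw [← hq.isOpen_preimage, e]
  exact hs

/-- Closed scale invariant conditions on length functions pass to the closure of Outer Space. -/
theorem mem_of_mk_mem_closure {s : Set (FreeGroup (Fin n) → ℝ)} (hs : IsClosed s)
    (h : ∀ f, ∀ c : ℝ, 0 < c → c • f ∈ s → f ∈ s) (hlen : ∀ A : MarkedGraph n, A.len ∈ s)
    {f : FreeGroup (Fin n) → ℝ} (hf : mk f ∈ closure (Set.range (CV.proj (n := n)))) :
    f ∈ s := by
  by_contra hfs
  -- The complement is open and scale invariant, so its image is a neighbourhood of `mk f` and must
  -- meet Outer Space, where every length function lies in `s`.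
  have hopen : IsOpen (mk '' sᶜ) :=
    isOpen_image_mk hs.isOpen_compl fun g hg c hc hcg => hg (h g c hc hcg)
  obtain ⟨_, ⟨g, hg, rfl⟩, ⟨A, hA⟩⟩ := mem_closure_iff.1 hf _ hopen ⟨f, hfs, rfl⟩
  induction A using Quotient.inductionOn with
  | h A =>
    obtain ⟨c, hc, he⟩ := mk_eq_mk_iff.1 (show mk g = mk A.len from hA.symm)
    exact hg (h g c hc (he ▸ hlen A))

end ProjLength

/-- The bound of `exists_len_le` has `C` and `g` independent of `B`. For each `w` it involves
finitely many values of the length function, each linearly, so it passes to pointwise limits and to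
multiples. -/
theorem MarkedGraph.lambdaR_lt_top {n : ℕ} (A : MarkedGraph n) {f : FreeGroup (Fin n) → ℝ}
    (hf : ProjLength.mk f ∈ closure (Set.range (CV.proj (n := n)))) : lambdaR A.len f < ⊤ := by
  obtain ⟨C, g, h⟩ := A.exists_len_le
  have hmem : ∀ w, f w ≤ C * A.len w * (∑ i, f (g i) + ∑ i, ∑ j, f (g i * g j)) := by
    refine ProjLength.mem_of_mk_mem_closure (s := {f : FreeGroup (Fin n) → ℝ |
      ∀ w, f w ≤ C * A.len w * (∑ i, f (g i) + ∑ i, ∑ j, f (g i * g j))})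
      ?_ ?_ (fun B w => h B w) hf
    · rw [Set.ofPred_forall]
      exact isClosed_iInter fun w => isClosed_le (by fun_prop) (by fun_prop)
    · intro f c hc hcf w
      have h1 := hcf w
      simp only [Pi.smul_apply, smul_eq_mul, ← Finset.mul_sum] at h1
      refine le_of_mul_le_mul_left (h1.trans_eq ?_) hc
      ring
  refine lt_of_le_of_lt (iSup₂_le fun w hw => ?_)
    (EReal.coe_lt_top (C * (∑ i, f (g i) + ∑ i, ∑ j, f (g i * g j))))
  rw [EReal.coe_le_coe_iff, div_le_iff₀ (A.len_pos hw)]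
  exact (hmem w).trans_eq (by ring)

/-! ### Lengths in roses -/

namespace MarkedGraph

open WeightedWord

variable {n : ℕ}

theorem volume_pos (A : MarkedGraph n) : 0 < A.volume := by
  have h : 0 < A.valence A.base := by linarith [A.three_le_valence A.base]
  obtain ⟨⟨d, -⟩⟩ := (Nat.card_pos_iff.1 h).1
  exact Finset.sum_pos (fun e _ => A.length_pos e) ⟨d.1, Finset.mem_univ _⟩

theorem len_rose (hn : 2 ≤ n) (ℓ : Fin n → ℝ) (hℓ : ∀ i, 0 < ℓ i) (w : FreeGroup (Fin n)) :
    (rose hn ℓ hℓ).len w = cyclicWeight ℓ w :=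
  len_eq_cyclicWeight _ w

theorem len_rose_of (hn : 2 ≤ n) (ℓ : Fin n → ℝ) (hℓ : ∀ i, 0 < ℓ i) (i : Fin n) :
    (rose hn ℓ hℓ).len (FreeGroup.of i) = ℓ i := by
  rw [len_rose, cyclicWeight_of]

/-- Both lengths are weights of the same cyclically reduced word, so the comparison is letter by
letter. -/
theorem len_rose_le_mul (hn : 2 ≤ n) {ℓ ℓ' : Fin n → ℝ} (hℓ : ∀ i, 0 < ℓ i)
    (hℓ' : ∀ i, 0 < ℓ' i) {c : ℝ} (h : ∀ i, ℓ' i ≤ c * ℓ i) (w : FreeGroup (Fin n)) :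
    (rose hn ℓ' hℓ').len w ≤ c * (rose hn ℓ hℓ).len w := by
  rw [len_rose, len_rose, cyclicWeight, cyclicWeight, wordWeight, wordWeight,
    ← List.sum_map_mul_left]
  exact List.sum_le_sum fun d _ => h d.1

end MarkedGraph

/-! ### Estimates for the metric and criteria against accumulation -/

namespace CV

variable {n : ℕ}

theorem unitLen_mk (A : MarkedGraph n) (w : FreeGroup (Fin n)) :
    (mk A).unitLen w = A.len w / A.volume := rfl

theorem unitLen_pos (B : CV n) {w : FreeGroup (Fin n)} (hw : w ≠ 1) : 0 < B.unitLen w := by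
  induction B using Quotient.inductionOn with
  | h B => exact div_pos (B.len_pos hw) B.volume_pos

theorem dR_le_log {A B : CV n} {c : ℝ} (hc : 0 < c)
    (h : ∀ w, w ≠ 1 → B.unitLen w ≤ c * A.unitLen w) : dR A B ≤ (Real.log c : ℝ) := by
  rw [dR, ← ENNReal.log_ofReal_of_pos hc]
  refine ENNReal.log_monotone ?_
  rw [← EReal.real_coe_toENNReal]
  refine EReal.toENNReal_le_toENNReal (iSup₂_le fun w hw => ?_)
  rw [EReal.coe_le_coe_iff, div_le_iff₀ (A.unitLen_pos hw)]
  exact h w hw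

theorem log_le_dR {A B : CV n} {c : ℝ} (hc : 0 < c) {w : FreeGroup (Fin n)} (hw : w ≠ 1)
    (h : c * A.unitLen w ≤ B.unitLen w) : (Real.log c : ℝ) ≤ dR A B := by
  rw [dR, ← ENNReal.log_ofReal_of_pos hc]
  refine ENNReal.log_monotone ?_
  rw [← EReal.real_coe_toENNReal]
  refine EReal.toENNReal_le_toENNReal (le_iSup₂_of_le w hw ?_)
  rwa [EReal.coe_le_coe_iff, le_div_iff₀ (A.unitLen_pos hw)]

/-- If the unit lengths of a nontrivial element tend to zero along a sequence, then the sequence has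
no subsequence with `d_R(A_k, B) → 0`. -/
theorem not_mapClusterPt_dR {a : ℕ → CV n} {w : FreeGroup (Fin n)} (hw : w ≠ 1)
    (ha : Tendsto (fun k => (a k).unitLen w) atTop (𝓝 0)) (B : CV n) :
    ¬ MapClusterPt 0 atTop (fun k => dR (a k) B) := by
  intro hB
  -- The threshold `1` is arbitrary; it corresponds to the stretching factor `Real.exp 1`.
  have h1 : ∃ᶠ k in atTop, dR (a k) B < 1 :=
    mapClusterPt_iff_frequently.1 hB _ (Iio_mem_nhds zero_lt_one)
  have h2 : Tendsto (fun k => Real.exp 1 * (a k).unitLen w) atTop (𝓝 0) := by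
    simpa using ha.const_mul (Real.exp 1)
  refine h1 ((h2.eventually_lt_const (B.unitLen_pos hw)).mono fun k hk => ?_)
  have h3 := log_le_dR (Real.exp_pos 1) hw hk.le
  rw [Real.log_exp] at h3
  exact not_lt.2 h3

/-- If the length of `v` becomes arbitrarily small relative to that of `w` along a sequence, then
the sequence has no accumulation point in Outer Space. -/
theorem not_mapClusterPt {a : ℕ → MarkedGraph n} {v w : FreeGroup (Fin n)} (hv : v ≠ 1)
    (hw : w ≠ 1) (ha : Tendsto (fun k => (a k).len v / (a k).len w) atTop (𝓝 0)) (B : CV n) :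
    ¬ MapClusterPt B atTop (fun k => mk (a k)) := by
  induction B using Quotient.inductionOn with
  | h B =>
    intro hB
    -- Half of the ratio at `B`: the scale-invariant open condition `c * f w < f v` holds at `B` but
    -- eventually fails along the sequence.
    set c : ℝ := B.len v / (2 * B.len w) with hc
    have hv0 := B.len_pos hv
    have hw0 := B.len_pos hw
    have hc0 : 0 < c := by positivity
    set s : Set (FreeGroup (Fin n) → ℝ) := {f | c * f w < f v} with hs
    have hscale : ∀ f ∈ s, ∀ r : ℝ, 0 < r → r • f ∈ s := by
      intro f hf r hr
      have h1 : c * f w < f v := hf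
      change c * (r * f w) < r * f v
      nlinarith
    have hopen : IsOpen (ProjLength.mk '' s) :=
      ProjLength.isOpen_image_mk (isOpen_lt (by fun_prop) (by fun_prop)) hscale
    have hBs : B.len ∈ s := by
      have : c * B.len w = B.len v / 2 := by rw [hc]; field_simp
      change c * B.len w < B.len v
      linarith
    have hnhds : proj ⁻¹' (ProjLength.mk '' s) ∈ 𝓝 (mk B) :=
      (isOpen_induced hopen).mem_nhds ⟨B.len, hBs, rfl⟩
    refine mapClusterPt_iff_frequently.1 hB _ hnhds
      ((ha.eventually_lt_const hc0).mono fun k hk => ?_)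
    rintro ⟨f, hf, hfk⟩
    obtain ⟨r, hr, he⟩ := ProjLength.mk_eq_mk_iff.1
      (show ProjLength.mk f = ProjLength.mk (a k).len from hfk)
    have h1 : c * (a k).len w < (a k).len v := by
      have := hscale f hf r hr
      rwa [← he] at this
    rw [div_lt_iff₀ ((a k).len_pos hw)] at hk
    linarith

end CV

/-- The petal lengths of the rose of volume one in which the petal `i₀` is `k + 1` times shorter
than all other petals. -/
noncomputable def shrinkingPetals {n : ℕ} (i₀ : Fin n) (k : ℕ) (i : Fin n) : ℝ :=
  (if i = i₀ then 1 else (k + 1 : ℝ)) / ((n - 1) * (k + 1) + 1)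

/-! ### The roses with one shrinking petal -/

section shrinkingPetals

variable {n : ℕ} (hn : 2 ≤ n) (i₀ : Fin n)

theorem shrinkingPetals_self (k : ℕ) : shrinkingPetals i₀ k i₀ = 1 / ((n - 1) * (k + 1) + 1) := by
  rw [shrinkingPetals, if_pos rfl]

theorem shrinkingPetals_of_ne (k : ℕ) {i : Fin n} (hi : i ≠ i₀) :
    shrinkingPetals i₀ k i = (k + 1) / ((n - 1) * (k + 1) + 1) := by
  rw [shrinkingPetals, if_neg hi]

theorem one_le_cast_sub_one (hn : 2 ≤ n) : (1 : ℝ) ≤ n - 1 := by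
  have : (2 : ℝ) ≤ n := by exact_mod_cast hn
  linarith

theorem shrinkingPetals_denominator_ge (hn : 2 ≤ n) (k : ℕ) :
    (k : ℝ) + 1 ≤ ((n : ℝ) - 1) * (k + 1) + 1 := by
  nlinarith [one_le_cast_sub_one hn, (Nat.cast_nonneg k : (0 : ℝ) ≤ k)]

theorem shrinkingPetals_denominator_pos (hn : 2 ≤ n) (k : ℕ) :
    0 < ((n : ℝ) - 1) * (k + 1) + 1 :=
  lt_of_lt_of_le (by positivity) (shrinkingPetals_denominator_ge hn k)

theorem shrinkingPetals_pos (hn : 2 ≤ n) (k : ℕ) (i : Fin n) : 0 < shrinkingPetals i₀ k i := by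
  refine div_pos ?_ (shrinkingPetals_denominator_pos hn k)
  split_ifs <;> positivity

theorem sum_shrinkingPetals (hn : 2 ≤ n) (k : ℕ) : ∑ i, shrinkingPetals i₀ k i = 1 := by
  rw [← Finset.add_sum_erase _ _ (Finset.mem_univ i₀), shrinkingPetals_self,
    Finset.sum_congr rfl fun i hi => shrinkingPetals_of_ne i₀ k (Finset.ne_of_mem_erase hi),
    Finset.sum_const, Finset.card_erase_of_mem (Finset.mem_univ _), Finset.card_univ,
    Fintype.card_fin, nsmul_eq_mul, Nat.cast_sub (by omega : 1 ≤ n), Nat.cast_one]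
  have := (shrinkingPetals_denominator_pos hn k).ne'
  field_simp
  ring

/-- The short petal only decreases. Each other petal increases with limit `1 / (n - 1)`, hence by a
factor of at most `1 + 1 / ((n - 1) * (k + 1))`, and `n - 1 ≥ 1`. -/
theorem shrinkingPetals_add_le (hn : 2 ≤ n) (k m : ℕ) (i : Fin n) :
    shrinkingPetals i₀ (k + m) i ≤ (1 + 1 / (k + 1)) * shrinkingPetals i₀ k i := by
  have h1 := one_le_cast_sub_one hn
  have hk := shrinkingPetals_denominator_pos hn k
  have hkm := shrinkingPetals_denominator_pos hn (k + m)
  have hm : (0 : ℝ) ≤ m := Nat.cast_nonneg m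
  have hk0 : (0 : ℝ) ≤ k := Nat.cast_nonneg k
  have e : (1 + 1 / ((k : ℝ) + 1)) = (k + 2) / (k + 1) := by field_simp; ring
  rw [e]
  push_cast at hkm
  obtain rfl | hi := eq_or_ne i i₀
  · rw [shrinkingPetals_self, shrinkingPetals_self, div_mul_div_comm,
      div_le_div_iff₀ (by exact_mod_cast hkm) (by positivity)]
    push_cast
    have h2 : ((n : ℝ) - 1) * (k + 1) + 1 ≤ (n - 1) * (k + m + 1) + 1 := by nlinarith
    nlinarith
  · rw [shrinkingPetals_of_ne i₀ _ hi, shrinkingPetals_of_ne i₀ _ hi, div_mul_div_comm,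
      div_le_div_iff₀ (by exact_mod_cast hkm) (by positivity)]
    push_cast
    set x : ℝ := (n : ℝ) - 1
    set y : ℝ := (k : ℝ) + 1
    have h2 : (k : ℝ) + m + 1 = y + m := by ring
    have h3 : (k : ℝ) + 2 = y + 1 := by ring
    have hy : 0 < y := by positivity
    rw [h2, h3]
    -- The right side minus the left side is `x * (y + m) + 1 - m`, which is positive as `x ≥ 1`.
    have h4 : (y + m) * (x * y + 1) ≤ (y + 1) * (x * (y + m) + 1) := by nlinarith
    nlinarith

theorem tendsto_shrinkingPetals_self (hn : 2 ≤ n) :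
    Tendsto (fun k => shrinkingPetals i₀ k i₀) atTop (𝓝 0) := by
  refine squeeze_zero (fun k => (shrinkingPetals_pos i₀ hn k i₀).le) (fun k => ?_)
    tendsto_one_div_add_atTop_nhds_zero_nat
  rw [shrinkingPetals_self]
  exact one_div_le_one_div_of_le (by positivity) (shrinkingPetals_denominator_ge hn k)

theorem shrinkingPetals_self_eq (hn : 2 ≤ n) (k : ℕ) {i : Fin n} (hi : i ≠ i₀) :
    shrinkingPetals i₀ k i₀ = shrinkingPetals i₀ k i / (k + 1) := by
  rw [shrinkingPetals_self, shrinkingPetals_of_ne i₀ k hi]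
  have := (shrinkingPetals_denominator_pos hn k).ne'
  field_simp

/-- The rose of volume one in which the petal `i₀` is `k + 1` times shorter than all others. -/
noncomputable def shrinkingRose (k : ℕ) : MarkedGraph n :=
  MarkedGraph.rose hn (shrinkingPetals i₀ k) (shrinkingPetals_pos i₀ hn k)

theorem volume_shrinkingRose (k : ℕ) : (shrinkingRose hn i₀ k).volume = 1 :=
  sum_shrinkingPetals i₀ hn k

theorem unitLen_shrinkingRose (k : ℕ) (w : FreeGroup (Fin n)) :
    (CV.mk (shrinkingRose hn i₀ k)).unitLen w = (shrinkingRose hn i₀ k).len w := by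
  rw [CV.unitLen_mk, volume_shrinkingRose, div_one]

theorem len_shrinkingRose_of (k : ℕ) (i : Fin n) :
    (shrinkingRose hn i₀ k).len (FreeGroup.of i) = shrinkingPetals i₀ k i :=
  MarkedGraph.len_rose_of hn _ _ i

/-- The bound on the petals gives `d_R ≤ log (1 + 1 / (k + 1)) ≤ 1 / (k + 1)`, independently of `m`.
-/
theorem rightCauchy_shrinkingRose : CV.RightCauchy fun k => CV.mk (shrinkingRose hn i₀ k) := by
  intro ε hε
  obtain ⟨K, hK⟩ := exists_nat_one_div_lt hε
  refine ⟨K, fun k hk m => ?_⟩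
  have hpos : (0 : ℝ) < 1 + 1 / (k + 1) := by positivity
  refine lt_of_le_of_lt (CV.dR_le_log hpos fun w _ => ?_) (EReal.coe_lt_coe_iff.2 ?_)
  · rw [unitLen_shrinkingRose, unitLen_shrinkingRose]
    exact MarkedGraph.len_rose_le_mul hn _ _ (shrinkingPetals_add_le i₀ hn k m) w
  · have h1 := Real.log_le_sub_one_of_pos hpos
    have h2 : 1 / ((k : ℝ) + 1) ≤ 1 / (K + 1) := by
      have : (K : ℝ) ≤ k := by exact_mod_cast hk
      exact one_div_le_one_div_of_le (by positivity) (by linarith)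
    linarith

theorem not_mapClusterPt_dR_shrinkingRose (B : CV n) :
    ¬ MapClusterPt 0 atTop (fun k => CV.dR (CV.mk (shrinkingRose hn i₀ k)) B) := by
  refine CV.not_mapClusterPt_dR (FreeGroup.of_ne_one i₀) ?_ B
  simp only [unitLen_shrinkingRose, len_shrinkingRose_of]
  exact tendsto_shrinkingPetals_self i₀ hn

/-- The topology sees only ratios of lengths, so the short petal is measured against a second petal,
which exists since `n ≥ 2`. -/
theorem not_mapClusterPt_shrinkingRose (B : CV n) :
    ¬ MapClusterPt B atTop (fun k => CV.mk (shrinkingRose hn i₀ k)) := by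
  have : Nontrivial (Fin n) := Fin.nontrivial_iff_two_le.2 hn
  obtain ⟨j, hj⟩ := exists_ne i₀
  refine CV.not_mapClusterPt (FreeGroup.of_ne_one i₀) (FreeGroup.of_ne_one j) ?_ B
  simp only [len_shrinkingRose_of]
  have e : ∀ k : ℕ, shrinkingPetals i₀ k i₀ / shrinkingPetals i₀ k j = 1 / ((k : ℝ) + 1) := by
    intro k
    have := (shrinkingPetals_pos i₀ hn k j).ne'
    rw [shrinkingPetals_self_eq i₀ hn k hj]
    field_simp
  simp only [e]
  exact tendsto_one_div_add_atTop_nhds_zero_nat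

end shrinkingPetals

theorem theorem4p19 (n : ℕ) (hn : 2 ≤ n) :
    ¬ CV.RightComplete n ∧
    (∀ i₀ : Fin n, ∃ (ℓ : ℕ → Fin n → ℝ) (hℓ : ∀ k i, 0 < ℓ k i),
      (∀ k, (MarkedGraph.rose hn (ℓ k) (hℓ k)).volume = 1) ∧
      (∀ k i, i ≠ i₀ → ℓ k i₀ = ℓ k i / (k + 1)) ∧
      CV.RightCauchy (fun k => CV.mk (MarkedGraph.rose hn (ℓ k) (hℓ k))) ∧
      ∀ B : CV n,
        ¬ MapClusterPt B atTop (fun k => CV.mk (MarkedGraph.rose hn (ℓ k) (hℓ k))) ∧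
        ¬ MapClusterPt 0 atTop (fun k => CV.dR (CV.mk (MarkedGraph.rose hn (ℓ k) (hℓ k))) B)) ∧
    (∀ (A : MarkedGraph n) (f : FreeGroup (Fin n) → ℝ), ProjLength.mk f ∈ CV.boundary n →
      lambdaR A.len f < ⊤) := by
  refine ⟨fun hcomplete => ?_, fun i₀ => ?_, fun A f hf => A.lambdaR_lt_top hf.1⟩
  · have i₀ : Fin n := ⟨0, by omega⟩
    obtain ⟨B, hB⟩ := hcomplete _ (rightCauchy_shrinkingRose hn i₀)
    exact not_mapClusterPt_shrinkingRose hn i₀ B hB.mapClusterPt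
  · exact ⟨shrinkingPetals i₀, shrinkingPetals_pos i₀ hn, volume_shrinkingRose hn i₀,
      fun k i hi => shrinkingPetals_self_eq i₀ hn k hi, rightCauchy_shrinkingRose hn i₀,
      fun B => ⟨not_mapClusterPt_shrinkingRose hn i₀ B,
        not_mapClusterPt_dR_shrinkingRose hn i₀ B⟩⟩
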